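/- Let $R$ be an integral domain of characteristic different from $2$ such that every locally free $R$-module of finite rank (equivalently, every finitely generated projective $R$-module) is free. A *twisted binary quadratic form* over $R$ is a pair $(V,q)$, where $V$ is a locally free $R$-module of rank $2$ and $q \in \mathrm{Sym}^2 V \otimes_R (\Lambda^2 V)^\vee$. For a basis $(x,y)$ of $V$, let $\det_{(x,y)} \in (\Lambda^2 V)^\vee$ be the linear form with $x \wedge y \mapsto 1$; then $q = (a x^2 + b xy + c y^2) \otimes \det_{(x,y)}$ for unique $a,b,c \in R$, and one says that $(V,q)$ is expressed as $[a,b,c]$ in the basis $(x,y)$. The form is *primitive* if $a,b,c$ generate the unit ideal of $R$; its *natural discriminant* is $b^2-4ac \in R$, and its *natural parity* is the class of $b$ in $R/2R$ (none of these depends on the basis). Two forms $(V,q)$ and $(V',q')$ are in the same $\mathrm{GL}_2^{tw}$-class if there is an isomorphism $f\colon V \to V'$ of $R$-modules such that $\mathrm{Sym}^2 f \otimes ((\Lambda^2 f)^\vee)^{-1}$ sends $q$ to $q'$; in coordinates this is the action of $\mathrm{GL}_2(R)$ by $\begin{pmatrix}\alpha&\beta\\ \gamma&\delta\end{pmatrix}\cdot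 q = \frac{1}{\alpha\delta-\beta\gamma}\, q(\alpha x+\beta y,\gamma x+\delta y)$. Let $\pi \in R/2R$, let $\tilde\pi \in R$ be a lift of $\pi$, and let $\Delta \in R$ satisfy $\Delta \equiv \tilde\pi^2 \pmod{4R}$. Then there is a bijection $$\left\{\begin{array}{c}\mathrm{GL}_2^{tw}\text{-classes of primitive twisted binary quadratic forms over } R\\ \text{with natural discriminant } \Delta \text{ and natural parity } \pi\end{array}\right\} \longleftrightarrow \mathrm{Pic}\left(R[\omega]\Big/\Big\langle \omega^2+\tilde\pi\omega-\tfrac{\Delta-\tilde\pi^2}{4}\Big\rangle\right)$$ such that, whenever a form of this type is expressed as $[a,b,c]$ with $a \neq 0$ in some basis, the ideal $\left\langle \omega+\frac{\tilde\pi-b}{2},\, a\right\rangle$ is an invertible module and the class of the form is sent to the class of this ideal. -/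

import Mathlib

open scoped TensorProduct

universe u

/-- `Sym² V`: the degree two component of the symmetric algebra of `V`, that is, the submodule
generated by the products `v * w` with `v, w ∈ V`. -/
noncomputable def SymSquare (R : Type u) [CommRing R] (V : Type u) [AddCommGroup V] [Module R V] :
    Submodule R (SymmetricAlgebra R V) :=
  LinearMap.range (SymmetricAlgebra.ι R V) ^ 2

namespace SymSquare

variable {R : Type u} [CommRing R] {V W X : Type u} [AddCommGroup V] [Module R V]
  [AddCommGroup W] [Module R W] [AddCommGroup X] [Module R X]

/-- The product `v * w` in `Sym² V` of two elements of `V`. -/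
noncomputable def mk (v w : V) : SymSquare R V :=
  ⟨SymmetricAlgebra.ι R V v * SymmetricAlgebra.ι R V w, by
    rw [SymSquare, pow_two]
    exact Submodule.mul_mem_mul ⟨v, rfl⟩ ⟨w, rfl⟩⟩

/-- The algebra morphism `Sym V → Sym W` induced by a linear map `V → W`. -/
noncomputable def algMap (f : V →ₗ[R] W) : SymmetricAlgebra R V →ₐ[R] SymmetricAlgebra R W :=
  SymmetricAlgebra.lift (SymmetricAlgebra.ι R W ∘ₗ f)

theorem algMap_ι (f : V →ₗ[R] W) (v : V) :
    algMap f (SymmetricAlgebra.ι R V v) = SymmetricAlgebra.ι R W (f v) := by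
  simp [algMap]

theorem algMap_id : algMap (LinearMap.id : V →ₗ[R] V) = AlgHom.id R _ := by
  ext v
  simp [algMap]

theorem algMap_comp (g : W →ₗ[R] X) (f : V →ₗ[R] W) :
    algMap (g ∘ₗ f) = (algMap g).comp (algMap f) := by
  ext v
  simp [algMap]

theorem algMap_mem (f : V →ₗ[R] W) (s : SymmetricAlgebra R V) (hs : s ∈ SymSquare R V) :
    (algMap f).toLinearMap s ∈ SymSquare R W := by
  have h : (SymSquare R V).map (algMap f).toLinearMap ≤ SymSquare R W := by
    rw [SymSquare, SymSquare, Submodule.map_pow]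
    refine pow_le_pow_left' ?_ 2
    rintro _ ⟨_, ⟨v, rfl⟩, rfl⟩
    exact ⟨f v, (algMap_ι f v).symm⟩
  exact h ⟨s, hs, rfl⟩

/-- `Sym² f : Sym² V → Sym² W`, which sends `v * w` to `f v * f w`. -/
noncomputable def map (f : V →ₗ[R] W) : SymSquare R V →ₗ[R] SymSquare R W :=
  (algMap f).toLinearMap.restrict (algMap_mem f)

theorem map_mk (f : V →ₗ[R] W) (v w : V) : map f (mk v w) = mk (f v) (f w) := by
  apply Subtype.ext
  simp [map, mk, algMap_ι]

theorem map_id : map (LinearMap.id : V →ₗ[R] V) = LinearMap.id := by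
  ext s
  simp [map, algMap_id]

theorem map_comp (g : W →ₗ[R] X) (f : V →ₗ[R] W) : map (g ∘ₗ f) = map g ∘ₗ map f := by
  ext s
  simp [map, algMap_comp]

end SymSquare

/-- A twisted binary quadratic form `(V, q)` over `R`: a locally free `R`-module `V` of rank two
(that is, a finitely generated projective module of constant rank two) with an element `q` of
`Sym² V ⊗ (Λ² V)^∨`. -/
structure TwistedForm (R : Type u) [CommRing R] where
  V : Type u
  [addCommGroup : AddCommGroup V]
  [module : Module R V]
  [finite : Module.Finite R V]
  [projective : Module.Projective R V]
  rank_eq : ∀ p : PrimeSpectrum R, Module.rankAtStalk (R := R) V p = 2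
  q : SymSquare R V ⊗[R] Module.Dual R (⋀[R]^2 V)

attribute [instance] TwistedForm.addCommGroup TwistedForm.module TwistedForm.finite
  TwistedForm.projective

namespace TwistedForm

section Functoriality

variable {R : Type u} [CommRing R] {V W X : Type u} [AddCommGroup V] [Module R V]
  [AddCommGroup W] [Module R W] [AddCommGroup X] [Module R X]

/-- The map `(Λ² V)^∨ → (Λ² W)^∨` induced by an isomorphism `f : V ≃ W`, namely
`φ ↦ φ ∘ Λ² f⁻¹`. -/
noncomputable def dualMap (f : V ≃ₗ[R] W) :
    Module.Dual R (⋀[R]^2 V) →ₗ[R] Module.Dual R (⋀[R]^2 W) :=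
  (exteriorPower.map 2 f.symm.toLinearMap).dualMap

/-- The map `Sym² V ⊗ (Λ² V)^∨ → Sym² W ⊗ (Λ² W)^∨` induced by an isomorphism `f : V ≃ W`. -/
noncomputable def transport (f : V ≃ₗ[R] W) :
    SymSquare R V ⊗[R] Module.Dual R (⋀[R]^2 V) →ₗ[R]
      SymSquare R W ⊗[R] Module.Dual R (⋀[R]^2 W) :=
  TensorProduct.map (SymSquare.map f.toLinearMap) (dualMap f)

theorem transport_refl : transport (LinearEquiv.refl R V) = LinearMap.id := by
  have h : dualMap (LinearEquiv.refl R V) = LinearMap.id := by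
    simp [dualMap, LinearMap.dualMap_id]
  rw [transport, h, LinearEquiv.refl_toLinearMap, SymSquare.map_id, TensorProduct.map_id]

theorem transport_trans (f : V ≃ₗ[R] W) (g : W ≃ₗ[R] X) :
    transport (f.trans g) = transport g ∘ₗ transport f := by
  have h : dualMap (f.trans g) = dualMap g ∘ₗ dualMap f := by
    rw [dualMap, dualMap, dualMap, LinearMap.dualMap_comp_dualMap, ← exteriorPower.map_comp]
    rfl
  rw [transport, transport, transport, h, ← TensorProduct.map_comp, ← SymSquare.map_comp]
  rfl

/-- `det_{(x,y)} ∈ (Λ² V)^∨`, for a basis `(x, y)` of `V`: the linear form with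
`x ∧ y ↦ 1`. -/
noncomputable def detForm (e : Module.Basis (Fin 2) R V) : Module.Dual R (⋀[R]^2 V) :=
  exteriorPower.alternatingMapLinearEquiv e.det

end Functoriality

variable {R : Type u} [CommRing R]

/-- `(V, q)` and `(V', q')` are equivalent (lie in the same class for the twisted action of `GL₂`)
when an isomorphism `V ≃ V'` sends `q` to `q'`. -/
def Equivalent (Q Q' : TwistedForm R) : Prop :=
  ∃ f : Q.V ≃ₗ[R] Q'.V, transport f Q.q = Q'.q

theorem equivalent_equivalence : Equivalence (Equivalent (R := R)) where
  refl Q := ⟨LinearEquiv.refl R Q.V, by rw [transport_refl, LinearMap.id_apply]⟩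
  symm := by
    rintro Q Q' ⟨f, hf⟩
    refine ⟨f.symm, ?_⟩
    rw [← hf, ← LinearMap.comp_apply, ← transport_trans, LinearEquiv.self_trans_symm,
      transport_refl, LinearMap.id_apply]
  trans := by
    rintro Q Q' Q'' ⟨f, hf⟩ ⟨g, hg⟩
    exact ⟨f.trans g, by rw [transport_trans, LinearMap.comp_apply, hf, hg]⟩

/-- In the basis `e = (x, y)` of `V`, one has `q = a x² z + b x y z + c y² z`, where
`z = det_{(x,y)}`. -/
def HasExpression (Q : TwistedForm R) (e : Module.Basis (Fin 2) R Q.V) (a b c : R) : Prop :=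
  Q.q = (a • SymSquare.mk (e 0) (e 0) + b • SymSquare.mk (e 0) (e 1)
    + c • SymSquare.mk (e 1) (e 1)) ⊗ₜ[R] detForm e

/-! The three notions below are read off on the bases of `V`. They are used only over rings over
which every finitely generated projective module is free, so that `V` does have a basis. -/

/-- The coefficients generate the unit ideal. -/
def IsPrimitive (Q : TwistedForm R) : Prop :=
  ∀ (e : Module.Basis (Fin 2) R Q.V) (a b c : R), Q.HasExpression e a b c →
    Ideal.span {a, b, c} = ⊤

/-- The natural discriminant `b² - 4ac` equals `Δ`. -/
def HasDiscriminant (Q : TwistedForm R) (Δ : R) : Prop :=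
  ∀ (e : Module.Basis (Fin 2) R Q.V) (a b c : R), Q.HasExpression e a b c →
    b ^ 2 - 4 * a * c = Δ

/-- The natural parity, that is, the class of `b` in `R / 2R`, equals `π`. -/
def HasParity (Q : TwistedForm R) (π : R ⧸ Ideal.span {(2 : R)}) : Prop :=
  ∀ (e : Module.Basis (Fin 2) R Q.V) (a b c : R), Q.HasExpression e a b c →
    Ideal.Quotient.mk (Ideal.span {(2 : R)}) b = π

variable (R) in
/-- The primitive twisted binary quadratic forms with natural discriminant `Δ` and natural
parity `π`. -/
def PrimitiveOfType (Δ : R) (π : R ⧸ Ideal.span {(2 : R)}) : Type (u + 1) :=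
  {Q : TwistedForm R // Q.IsPrimitive ∧ Q.HasDiscriminant Δ ∧ Q.HasParity π}

/-- Equivalence of primitive twisted binary quadratic forms of given type. -/
def PrimitiveOfType.setoid (Δ : R) (π : R ⧸ Ideal.span {(2 : R)}) :
    Setoid (PrimitiveOfType R Δ π) where
  r Q Q' := Equivalent Q.1 Q'.1
  iseqv :=
    ⟨fun Q => equivalent_equivalence.refl Q.1, fun h => equivalent_equivalence.symm h,
      fun h h' => equivalent_equivalence.trans h h'⟩

variable (R) in
/-- The set of classes of primitive twisted binary quadratic forms with natural discriminant `Δ`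
and natural parity `π`. -/
def Classes (Δ : R) (π : R ⧸ Ideal.span {(2 : R)}) : Type (u + 1) :=
  Quotient (PrimitiveOfType.setoid Δ π)

/-- The class of a form. -/
def PrimitiveOfType.toClass {Δ : R} {π : R ⧸ Ideal.span {(2 : R)}}
    (Q : PrimitiveOfType R Δ π) : Classes R Δ π :=
  Quotient.mk (PrimitiveOfType.setoid Δ π) Q

end TwistedForm

/-- The quadratic algebra `R[ω] / (ω² + t ω - d)`. -/
abbrev QuadAlg {R : Type u} [CommRing R] (t d : R) : Type u :=
  AdjoinRoot (Polynomial.X ^ 2 + Polynomial.C t * Polynomial.X - Polynomial.C d)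

/-- The element `ω` of `R[ω] / (ω² + t ω - d)`. -/
noncomputable abbrev QuadAlg.omega {R : Type u} [CommRing R] (t d : R) : QuadAlg t d :=
  AdjoinRoot.root (Polynomial.X ^ 2 + Polynomial.C t * Polynomial.X - Polynomial.C d)

/-- The ideal `⟨ω + k, a⟩` of `R[ω] / (ω² + t ω - d)`. -/
noncomputable def QuadAlg.formIdeal {R : Type u} [CommRing R] (t d k a : R) :
    Ideal (QuadAlg t d) :=
  Ideal.span {QuadAlg.omega t d + algebraMap R (QuadAlg t d) k, algebraMap R (QuadAlg t d) a}

/-! Write `A` for the quadratic algebra with basis `1, ω` over `R`. Projective modules being free,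
an invertible `A`-module `M` is free of rank two over `R`, so its `A`-structure is the matrix of `ω`
in an `R`-basis. As `ω` has trace `-t`, this matrix is given by three parameters `a, b, c` and by
`k` with `2k = t - b`. Intrinsically they are the coefficients of `m ↦ m ∧ ωm`, a quadratic form on
`M` with values in `Λ²M`, up to the sign of the middle one. Hence a change of basis of `M` acts on
`[a, b, c]` by the twisted substitution, and the relation `ω² + tω = d` fixes the discriminant.

Isomorphic modules therefore give equivalent forms (`HasFormAction.exists_twistedSubst`). Conversely
a form determines the action of `ω`, because `k` is unique when `2 ≠ 0` in a domain
(`HasFormAction.nonempty_linearEquiv`). Invertibility corresponds to primitivity: a primitive form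
with `a ≠ 0` gives the ideal `⟨ω + k, a⟩`, inverted by its conjugate up to the factor `a`
(`formIdeal_invertible`), and an invertible module gives a primitive form (`exists_hasFormAction`).
Every primitive form has an expression with `a ≠ 0`, so ideals reach all classes. -/

/-! ### Changes of basis in rank two -/

namespace Module.Basis

variable {R : Type*} [CommRing R] {V : Type*} [AddCommGroup V] [Module R V]

theorem exists_coeff_fin_two (e e' : Module.Basis (Fin 2) R V) :
    ∃ α β γ δ : R, e' 0 = α • e 0 + β • e 1 ∧ e' 1 = γ • e 0 + δ • e 1 ∧
      IsUnit (α * δ - β * γ) := by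
  refine ⟨e.repr (e' 0) 0, e.repr (e' 0) 1, e.repr (e' 1) 0, e.repr (e' 1) 1, ?_, ?_, ?_⟩
  · rw [← Fin.sum_univ_two fun i => e.repr (e' 0) i • e i, e.sum_repr]
  · rw [← Fin.sum_univ_two fun i => e.repr (e' 1) i • e i, e.sum_repr]
  · have h := e.isUnit_det e'
    rw [e.det_apply, Matrix.det_fin_two] at h
    simp only [toMatrix_apply] at h
    convert h using 1
    ring

theorem exists_of_isUnit_det_fin_two (e : Module.Basis (Fin 2) R V) {α β γ δ : R}
    (h : IsUnit (α * δ - β * γ)) :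
    ∃ e' : Module.Basis (Fin 2) R V,
      e' 0 = α • e 0 + β • e 1 ∧ e' 1 = γ • e 0 + δ • e 1 := by
  have hv : IsUnit (e.det ![α • e 0 + β • e 1, γ • e 0 + δ • e 1]) := by
    rw [e.det_apply, Matrix.det_fin_two]
    convert h using 1
    simp [toMatrix_apply, mul_comm]
  obtain ⟨h1, h2⟩ := (is_basis_iff_det e).2 hv
  refine ⟨Module.Basis.mk h1 h2.ge, ?_, ?_⟩ <;> simp

theorem exists_of_isUnit_det_fin_two_symm (e' : Module.Basis (Fin 2) R V) {α β γ δ : R}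
    (h : IsUnit (α * δ - β * γ)) :
    ∃ e : Module.Basis (Fin 2) R V,
      e' 0 = α • e 0 + β • e 1 ∧ e' 1 = γ • e 0 + δ • e 1 := by
  obtain ⟨u, hu⟩ := h.exists_right_inv
  have hu' : IsUnit ((u * δ) * (u * α) - (-u * β) * (-u * γ)) := by
    have : (u * δ) * (u * α) - (-u * β) * (-u * γ) = u * ((α * δ - β * γ) * u) := by ring
    rw [this, hu, mul_one]
    exact IsUnit.of_mul_eq_one_right _ hu
  obtain ⟨e, h0, h1⟩ := e'.exists_of_isUnit_det_fin_two hu'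
  refine ⟨e, ?_, ?_⟩
  · rw [h0, h1]
    linear_combination (norm := module) (-hu) • e' 0
  · rw [h0, h1]
    linear_combination (norm := module) (-hu) • e' 1

end Module.Basis

/-- The coefficients `[a, b, c]` are obtained from `[a', b', c']` by the twisted substitution with
matrix `(α β; γ δ)`. -/
structure TwistedSubst {R : Type*} [CommRing R] (α β γ δ a b c a' b' c' : R) : Prop where
  fst : (α * δ - β * γ) * a = a' * α ^ 2 + b' * (α * γ) + c' * γ ^ 2
  snd : (α * δ - β * γ) * b = 2 * a' * (α * β) + b' * (α * δ + β * γ) + 2 * c' * (γ * δ)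
  trd : (α * δ - β * γ) * c = a' * β ^ 2 + b' * (β * δ) + c' * δ ^ 2

/-! ### Coordinates of twisted forms -/

namespace SymSquare

variable {R : Type u} [CommRing R] {V : Type u} [AddCommGroup V] [Module R V]

theorem mk_comm (v w : V) : mk (R := R) v w = mk w v :=
  Subtype.ext (mul_comm _ _)

theorem mk_add_left (v v' w : V) : mk (R := R) (v + v') w = mk v w + mk v' w :=
  Subtype.ext (by simp [mk, add_mul])

theorem mk_smul_left (r : R) (v w : V) : mk (R := R) (r • v) w = r • mk v w :=
  Subtype.ext (by simp [mk])

theorem mk_add_right (v w w' : V) : mk (R := R) v (w + w') = mk v w + mk v w' := by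
  rw [mk_comm, mk_add_left, mk_comm w, mk_comm w']

theorem mk_smul_right (r : R) (v w : V) : mk (R := R) v (r • w) = r • mk v w := by
  rw [mk_comm, mk_smul_left, mk_comm]

theorem exists_expression (e : Module.Basis (Fin 2) R V) (s : SymSquare R V) :
    ∃ a b c : R, s = a • mk (e 0) (e 0) + b • mk (e 0) (e 1) + c • mk (e 1) (e 1) := by
  obtain ⟨s, hs⟩ := s
  have hs' := hs
  rw [SymSquare, pow_two] at hs'
  induction hs' using Submodule.mul_induction_on' with
  | mem_mul_mem x hx y hy =>
    obtain ⟨v, rfl⟩ := hx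
    obtain ⟨w, rfl⟩ := hy
    refine ⟨e.repr v 0 * e.repr w 0, e.repr v 0 * e.repr w 1 + e.repr v 1 * e.repr w 0,
      e.repr v 1 * e.repr w 1, ?_⟩
    change mk v w = _
    conv_lhs => rw [← e.sum_repr v, ← e.sum_repr w]
    simp only [Fin.sum_univ_two, mk_add_left, mk_add_right, mk_smul_left, mk_smul_right,
      mk_comm (e 1) (e 0)]
    module
  | add x hx y hy ihx ihy =>
    obtain ⟨a, b, c, h⟩ := ihx (by rw [SymSquare, pow_two]; exact hx)
    obtain ⟨a', b', c', h'⟩ := ihy (by rw [SymSquare, pow_two]; exact hy)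
    refine ⟨a + a', b + b', c + c', ?_⟩
    have : (⟨x + y, hs⟩ : SymSquare R V) = ⟨x, by rw [SymSquare, pow_two]; exact hx⟩ +
      ⟨y, by rw [SymSquare, pow_two]; exact hy⟩ := rfl
    rw [this, h, h']
    module

theorem expression_unique (e : Module.Basis (Fin 2) R V) {a b c a' b' c' : R}
    (h : a • mk (R := R) (e 0) (e 0) + b • mk (e 0) (e 1) + c • mk (e 1) (e 1) =
      a' • mk (e 0) (e 0) + b' • mk (e 0) (e 1) + c' • mk (e 1) (e 1)) :
    a = a' ∧ b = b' ∧ c = c' := by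
  -- Dehomogenize: `x ↦ X`, `y ↦ 1` turns the form into the polynomial `aX² + bX + c`, whose
  -- coefficients are unique.
  have h1 := congrArg (fun s : SymSquare R V => SymmetricAlgebra.lift
    (e.constr R ![(Polynomial.X : Polynomial R), 1]) s.1) h
  simp only [mk, Submodule.coe_add, Submodule.coe_smul, map_add, map_smul, map_mul,
    SymmetricAlgebra.lift_ι_apply, Module.Basis.constr_basis, Matrix.cons_val_zero,
    Matrix.cons_val_one, mul_one] at h1
  refine ⟨?_, ?_, ?_⟩
  · simpa [← pow_two, Polynomial.coeff_X, Polynomial.coeff_one] using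
      congrArg (Polynomial.coeff · 2) h1
  · simpa [← pow_two, Polynomial.coeff_X_pow, Polynomial.coeff_one] using
      congrArg (Polynomial.coeff · 1) h1
  · simpa [← pow_two] using congrArg (Polynomial.coeff · 0) h1

end SymSquare

namespace TwistedForm

section Bases

variable {R : Type u} [CommRing R] {V W : Type u} [AddCommGroup V] [Module R V]
  [AddCommGroup W] [Module R W]

theorem eq_smul_detForm (e : Module.Basis (Fin 2) R V) (φ : Module.Dual R (⋀[R]^2 V)) :
    φ = φ (exteriorPower.ιMulti R 2 e) • detForm e := by
  obtain ⟨f, rfl⟩ := (exteriorPower.alternatingMapLinearEquiv (R := R) (M := V) (N := R)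
    (n := 2)).surjective φ
  rw [exteriorPower.alternatingMapLinearEquiv_apply_ιMulti, detForm, ← map_smul]
  exact congrArg _ (f.eq_smul_basis_det e)

theorem detForm_ιMulti (e : Module.Basis (Fin 2) R V) (v : Fin 2 → V) :
    detForm e (exteriorPower.ιMulti R 2 v) = e.det v :=
  exteriorPower.alternatingMapLinearEquiv_apply_ιMulti _ _

theorem detForm_eq_smul (e e' : Module.Basis (Fin 2) R V) {α β γ δ : R}
    (h0 : e' 0 = α • e 0 + β • e 1) (h1 : e' 1 = γ • e 0 + δ • e 1) :
    detForm e = (α * δ - β * γ) • detForm e' := by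
  rw [eq_smul_detForm e' (detForm e), detForm_ιMulti, e.det_apply, Matrix.det_fin_two]
  simp [Module.Basis.toMatrix_apply, h0, h1, mul_comm]

theorem tmul_detForm_injective (e : Module.Basis (Fin 2) R V) {s s' : SymSquare R V}
    (h : s ⊗ₜ[R] detForm e = s' ⊗ₜ[R] detForm e) : s = s' := by
  -- Evaluating the second factor at `x ∧ y`, where `detForm e` is `1`, recovers the first factor.
  have h1 := congrArg ((TensorProduct.rid R _).toLinearMap ∘ₗ LinearMap.lTensor (SymSquare R V)
    (Module.Dual.eval R _ (exteriorPower.ιMulti R 2 e))) h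
  simpa [detForm_ιMulti, e.det_self] using h1

theorem exists_tmul_expression (e : Module.Basis (Fin 2) R V)
    (q : SymSquare R V ⊗[R] Module.Dual R (⋀[R]^2 V)) :
    ∃ a b c : R, q = (a • SymSquare.mk (e 0) (e 0) + b • SymSquare.mk (e 0) (e 1)
      + c • SymSquare.mk (e 1) (e 1)) ⊗ₜ[R] detForm e := by
  suffices h : ∃ s : SymSquare R V, q = s ⊗ₜ[R] detForm e by
    obtain ⟨s, rfl⟩ := h
    obtain ⟨a, b, c, rfl⟩ := SymSquare.exists_expression e s
    exact ⟨a, b, c, rfl⟩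
  induction q with
  | zero => exact ⟨0, by simp⟩
  | tmul s φ =>
    refine ⟨φ (exteriorPower.ιMulti R 2 e) • s, ?_⟩
    rw [TensorProduct.smul_tmul, ← eq_smul_detForm]
  | add q q' h h' =>
    obtain ⟨s, rfl⟩ := h
    obtain ⟨s', rfl⟩ := h'
    exact ⟨s + s', by rw [TensorProduct.add_tmul]⟩

theorem dualMap_detForm (f : V ≃ₗ[R] W) (e : Module.Basis (Fin 2) R V) :
    dualMap f (detForm e) = detForm (e.map f) := by
  rw [eq_smul_detForm (e.map f) (dualMap f (detForm e))]
  have : (dualMap f (detForm e)) (exteriorPower.ιMulti R 2 (e.map f)) = 1 := by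
    rw [dualMap, LinearMap.dualMap_apply, exteriorPower.map_apply_ιMulti, detForm_ιMulti]
    have h : (f.symm.toLinearMap : W → V) ∘ (e.map f) = e := by
      ext i
      simp
    rw [h, e.det_self]
  rw [this, one_smul]

end Bases

variable {R : Type u} [CommRing R]

theorem exists_hasExpression (Q : TwistedForm R) (e : Module.Basis (Fin 2) R Q.V) :
    ∃ a b c, Q.HasExpression e a b c :=
  exists_tmul_expression e Q.q

theorem HasExpression.transport {Q Q' : TwistedForm R} {e : Module.Basis (Fin 2) R Q.V}
    {a b c : R} (h : Q.HasExpression e a b c) {f : Q.V ≃ₗ[R] Q'.V}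
    (hf : TwistedForm.transport f Q.q = Q'.q) : Q'.HasExpression (e.map f) a b c := by
  rw [HasExpression, ← hf, h, TwistedForm.transport, TensorProduct.map_tmul, dualMap_detForm]
  simp [SymSquare.map_mk]

theorem equivalent_of_hasExpression {Q Q' : TwistedForm R} {e : Module.Basis (Fin 2) R Q.V}
    {e' : Module.Basis (Fin 2) R Q'.V} {a b c : R} (h : Q.HasExpression e a b c)
    (h' : Q'.HasExpression e' a b c) : Equivalent Q Q' := by
  refine ⟨e.equiv e' (Equiv.refl _), ?_⟩
  have he : e.map (e.equiv e' (Equiv.refl _)) = e' := by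
    ext i
    simp
  rw [h, h', TwistedForm.transport, TensorProduct.map_tmul, dualMap_detForm, he]
  simp [SymSquare.map_mk]

section ChangeOfBasis

variable {V : Type u} [AddCommGroup V] [Module R V] {e e' : Module.Basis (Fin 2) R V}
  {α β γ δ : R}

theorem expression_change (h0 : e' 0 = α • e 0 + β • e 1) (h1 : e' 1 = γ • e 0 + δ • e 1)
    (a' b' c' : R) :
    a' • SymSquare.mk (R := R) (e' 0) (e' 0) + b' • SymSquare.mk (e' 0) (e' 1)
      + c' • SymSquare.mk (e' 1) (e' 1) =
    (a' * α ^ 2 + b' * (α * γ) + c' * γ ^ 2) • SymSquare.mk (e 0) (e 0) +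
    (2 * a' * (α * β) + b' * (α * δ + β * γ) + 2 * c' * (γ * δ)) • SymSquare.mk (e 0) (e 1) +
    (a' * β ^ 2 + b' * (β * δ) + c' * δ ^ 2) • SymSquare.mk (e 1) (e 1) := by
  simp only [h0, h1, SymSquare.mk_add_left, SymSquare.mk_add_right, SymSquare.mk_smul_left,
    SymSquare.mk_smul_right, SymSquare.mk_comm (e 1) (e 0)]
  module

end ChangeOfBasis

variable {Q : TwistedForm R} {e e' : Module.Basis (Fin 2) R Q.V} {α β γ δ a b c a' b' c' : R}

theorem HasExpression.twistedSubst (h0 : e' 0 = α • e 0 + β • e 1)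
    (h1 : e' 1 = γ • e 0 + δ • e 1) (h : Q.HasExpression e a b c)
    (h' : Q.HasExpression e' a' b' c') : TwistedSubst α β γ δ a b c a' b' c' := by
  obtain ⟨α', β', γ', δ', h0', h1', -⟩ := e'.exists_coeff_fin_two e
  -- Of the inverse change of basis only the determinant matters; comparing the two determinant
  -- forms on `e' 0 ∧ e' 1` gives it.
  have hu : (α' * δ' - β' * γ') * (α * δ - β * γ) = 1 := by
    have := detForm_eq_smul e' e h0' h1'
    rw [detForm_eq_smul e e' h0 h1, smul_smul] at this
    have h2 := congrArg (· (exteriorPower.ιMulti R 2 e')) this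
    simpa [detForm_ιMulti, e'.det_self] using h2.symm
  rw [HasExpression] at h h'
  rw [h, expression_change h0 h1, detForm_eq_smul e' e h0' h1', TensorProduct.tmul_smul,
    TensorProduct.smul_tmul'] at h'
  have h3 := tmul_detForm_injective e h'
  simp only [smul_add, smul_smul] at h3
  obtain ⟨ha, hb, hc⟩ := SymSquare.expression_unique e h3
  refine ⟨?_, ?_, ?_⟩
  · rw [ha, ← mul_assoc, mul_comm (α * δ - β * γ), hu, one_mul]
  · rw [hb, ← mul_assoc, mul_comm (α * δ - β * γ), hu, one_mul]
  · rw [hc, ← mul_assoc, mul_comm (α * δ - β * γ), hu, one_mul]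

theorem HasExpression.of_twistedSubst (h0 : e' 0 = α • e 0 + β • e 1)
    (h1 : e' 1 = γ • e 0 + δ • e 1) (h' : Q.HasExpression e' a' b' c')
    (hs : TwistedSubst α β γ δ a b c a' b' c') :
    Q.HasExpression e a b c := by
  rw [HasExpression] at h' ⊢
  rw [h', expression_change h0 h1, ← hs.fst, ← hs.snd, ← hs.trd, detForm_eq_smul e e' h0 h1,
    ← TensorProduct.smul_tmul]
  simp only [smul_add, smul_smul]

end TwistedForm

/-! ### Invertible modules and ideals -/

/-- Every functional `φ` satisfies `x * φ m = φ (x • m) ∈ I`, and `1` is a sum of values `φ m`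
because the evaluation `M^∨ ⊗ M → A` is an isomorphism. -/
theorem Module.Invertible.mem_of_forall_smul_mem {A M : Type*} [CommRing A] [AddCommGroup M]
    [Module A M] [Module.Invertible A M] (I : Ideal A) {x : A}
    (h : ∀ m : M, x • m ∈ I • (⊤ : Submodule A M)) : x ∈ I := by
  have key : ∀ z : Module.Dual A M ⊗[A] M, x * Module.Invertible.linearEquiv A M z ∈ I := by
    intro z
    induction z with
    | zero => simp
    | add y z hy hz => rw [map_add, mul_add]; exact I.add_mem hy hz
    | tmul φ m =>
      have h1 : φ (x • m) ∈ I • (⊤ : Submodule A A) := by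
        have h2 := Submodule.mem_map_of_mem (f := φ) (h m)
        rw [Submodule.map_smul''] at h2
        exact Submodule.smul_mono le_rfl le_top h2
      rw [map_smul] at h1
      have h3 : Module.Invertible.linearEquiv A M (φ ⊗ₜ m) = φ m := rfl
      rw [h3]
      simpa using h1
  simpa using key ((Module.Invertible.linearEquiv A M).symm 1)

/-- In the total ring of fractions `a` becomes a unit, so `a⁻¹J` is inverse to `I` as a submodule.
-/
theorem Ideal.invertible_of_mul_eq_span_singleton {A : Type*} [CommRing A] {I J : Ideal A} {a : A}
    (ha : a ∈ nonZeroDivisors A) (h : I * J = Ideal.span {a}) : Module.Invertible A I := by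
  let F := Localization (nonZeroDivisors A)
  let φ : A →ₗ[A] F := Algebra.linearMap A F
  have hφ : Function.Injective φ := IsLocalization.injective F le_rfl
  obtain ⟨u, hu⟩ := (IsLocalization.map_units F (⟨a, ha⟩ : nonZeroDivisors A)).exists_right_inv
  have hIJ : Submodule.map φ I * (Submodule.span A {u} * Submodule.map φ J) = 1 := by
    have h1 : Submodule.map φ I * Submodule.map φ J = Submodule.span A {algebraMap A F a} := by
      change Submodule.map (Algebra.ofId A F).toLinearMap I *
        Submodule.map (Algebra.ofId A F).toLinearMap J = _
      rw [← Submodule.map_mul, h, Ideal.submodule_span_eq.symm, Submodule.map_span]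
      simp [Algebra.ofId_apply]
    rw [mul_left_comm, h1, Submodule.span_mul_span, Set.singleton_mul_singleton, mul_comm u, hu,
      Submodule.one_eq_span]
  have : Module.Invertible A (Units.mkOfMulEqOne _ _ hIJ).val := inferInstance
  have : Module.Invertible A (Submodule.map φ I) := this
  exact .congr (Submodule.equivMapOfInjective φ hφ I).symm

/-! ### The quadratic algebra and the action of `ω` -/

namespace QuadAlg

section CommRing

variable {R : Type u} [CommRing R] {t d : R}

theorem monic_poly (t d : R) :
    (Polynomial.X ^ 2 + Polynomial.C t * Polynomial.X - Polynomial.C d).Monic := by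
  monicity!

theorem omega_mul_omega : omega t d * omega t d =
    algebraMap R (QuadAlg t d) d - algebraMap R (QuadAlg t d) t * omega t d := by
  have h := AdjoinRoot.eval₂_root
    (Polynomial.X ^ 2 + Polynomial.C t * Polynomial.X - Polynomial.C d)
  simp only [Polynomial.eval₂_sub, Polynomial.eval₂_add, Polynomial.eval₂_mul,
    Polynomial.eval₂_pow, Polynomial.eval₂_X, Polynomial.eval₂_C] at h
  rw [AdjoinRoot.algebraMap_eq]
  linear_combination h

theorem exists_eq_add_mul_omega (x : QuadAlg t d) :
    ∃ r s : R, x = algebraMap R _ r + algebraMap R _ s * omega t d := by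
  induction x using AdjoinRoot.induction_on with
  | ih p =>
    rcases subsingleton_or_nontrivial R with hR | hR
    · have := Module.subsingleton R (QuadAlg t d)
      exact ⟨0, 0, Subsingleton.elim (α := QuadAlg t d) _ _⟩
    have h2 : (Polynomial.X ^ 2 + Polynomial.C t * Polynomial.X
        - Polynomial.C d).natDegree = 2 := by compute_degree!
    have hdeg : (p %ₘ (Polynomial.X ^ 2 + Polynomial.C t * Polynomial.X
        - Polynomial.C d)).natDegree ≤ 1 := by
      have h := Polynomial.natDegree_modByMonic_lt p (monic_poly t d)
        (fun h => by simp [h] at h2)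
      omega
    obtain ⟨s, r, h⟩ := Polynomial.exists_eq_X_add_C_of_natDegree_le_one hdeg
    refine ⟨r, s, ?_⟩
    have h1 : AdjoinRoot.mk (Polynomial.X ^ 2 + Polynomial.C t * Polynomial.X - Polynomial.C d) p =
        AdjoinRoot.mk _ (p %ₘ (Polynomial.X ^ 2 + Polynomial.C t * Polynomial.X
          - Polynomial.C d)) := by
      rw [AdjoinRoot.mk_eq_mk]
      exact ⟨p /ₘ (Polynomial.X ^ 2 + Polynomial.C t * Polynomial.X - Polynomial.C d), by linear_combination -Polynomial.modByMonic_add_div p (Polynomial.X ^ 2 +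
        Polynomial.C t * Polynomial.X - Polynomial.C d)⟩
    rw [h1, h]
    simp [AdjoinRoot.algebraMap_eq, add_comm]

theorem eq_zero_of_add_mul_omega {r s : R}
    (h : algebraMap R (QuadAlg t d) r + algebraMap R _ s * omega t d = 0) : r = 0 ∧ s = 0 := by
  nontriviality R
  have h1 : AdjoinRoot.mk (Polynomial.X ^ 2 + Polynomial.C t * Polynomial.X - Polynomial.C d)
      (Polynomial.C s * Polynomial.X + Polynomial.C r) = 0 := by
    rw [← h]
    simp [AdjoinRoot.algebraMap_eq, add_comm]
  have h2 : Polynomial.C s * Polynomial.X + Polynomial.C r = 0 := by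
    by_contra h0
    refine (monic_poly t d).not_dvd_of_degree_lt h0 ?_ (AdjoinRoot.mk_eq_zero.1 h1)
    have : (Polynomial.X ^ 2 + Polynomial.C t * Polynomial.X - Polynomial.C d).degree = 2 := by
      compute_degree!
    rw [this]
    exact lt_of_le_of_lt Polynomial.degree_linear_le (by norm_num)
  constructor
  · simpa using congrArg (Polynomial.coeff · 0) h2
  · simpa using congrArg (Polynomial.coeff · 1) h2

variable (t d) in
/-- The basis `1, ω`. -/
noncomputable def basis : Module.Basis (Fin 2) R (QuadAlg t d) :=
  Module.Basis.mk (v := ![1, omega t d])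
    (by
      rw [LinearIndependent.pair_iff]
      intro r s h
      simp only [Algebra.smul_def, mul_one] at h
      exact eq_zero_of_add_mul_omega h)
    (by
      rintro x -
      obtain ⟨r, s, rfl⟩ := exists_eq_add_mul_omega x
      simp only [Matrix.range_cons, Matrix.range_empty, Set.union_empty, Set.singleton_union]
      rw [Submodule.mem_span_pair]
      exact ⟨r, s, by simp [Algebra.smul_def]⟩)

theorem basis_repr_one (r s : R) :
    (basis t d).repr (algebraMap R (QuadAlg t d) r + algebraMap R _ s * omega t d) 1 = s := by
  have : algebraMap R (QuadAlg t d) r + algebraMap R _ s * omega t d =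
      r • basis t d 0 + s • basis t d 1 := by
    simp [basis, Algebra.smul_def]
  rw [this]
  simp

/-- The extended ideal is `J • ⊤`, and a coordinate function sends it into `J`. -/
theorem mem_of_add_mul_omega_mem_map {J : Ideal R} {r s : R}
    (h : algebraMap R (QuadAlg t d) r + algebraMap R _ s * omega t d ∈
      J.map (algebraMap R (QuadAlg t d))) : s ∈ J := by
  have h1 : algebraMap R (QuadAlg t d) r + algebraMap R _ s * omega t d ∈
      J • (⊤ : Submodule R (QuadAlg t d)) := by
    rw [Ideal.smul_top_eq_map]
    exact h
  have h2 := Submodule.mem_map_of_mem (f := (basis t d).coord 1) h1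
  rw [Submodule.map_smul''] at h2
  have h3 := Submodule.smul_mono (le_refl J) le_top h2
  rw [Module.Basis.coord_apply, basis_repr_one] at h3
  simpa using h3

instance : Module.Free R (QuadAlg t d) := .of_basis (basis t d)

instance : Module.Finite R (QuadAlg t d) := .of_basis (basis t d)

theorem finrank_eq [Nontrivial R] : Module.finrank R (QuadAlg t d) = 2 := by
  rw [Module.finrank_eq_card_basis (basis t d), Fintype.card_fin]

/-- In the `R`-basis `v` of the module `M`, the element `ω` acts as on the basis `(a, ω + k)` of
the ideal attached to the form `[a, b, c]`. -/
structure HasFormAction (t d : R) {M : Type*} [AddCommGroup M] [Module R M] [Module (QuadAlg t d) M]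
    (v : Module.Basis (Fin 2) R M) (a b c k : R) : Prop where
  fst : omega t d • v 0 = -k • v 0 + a • v 1
  snd : omega t d • v 1 = -c • v 0 + -(b + k) • v 1

section Modules

variable {M M' : Type*} [AddCommGroup M] [Module R M] [Module (QuadAlg t d) M]
  [IsScalarTower R (QuadAlg t d) M] [AddCommGroup M'] [Module R M'] [Module (QuadAlg t d) M']
  [IsScalarTower R (QuadAlg t d) M'] {v : Module.Basis (Fin 2) R M}
  {v' : Module.Basis (Fin 2) R M'}

theorem omega_smul_smul (r : R) (m : M) : omega t d • r • m = r • omega t d • m := by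
  rw [← algebraMap_smul (QuadAlg t d) r m, smul_comm, algebraMap_smul]

theorem omega_smul_omega_smul (m : M) :
    omega t d • omega t d • m = d • m + -t • omega t d • m := by
  rw [smul_smul, omega_mul_omega, sub_smul, mul_smul, algebraMap_smul, algebraMap_smul]
  module

theorem map_smul_of_map_omega_smul (f : M →ₗ[R] M')
    (hf : ∀ m, f (omega t d • m) = omega t d • f m) (x : QuadAlg t d) (m : M) :
    f (x • m) = x • f m := by
  obtain ⟨r, s, rfl⟩ := exists_eq_add_mul_omega x
  simp only [add_smul, mul_smul, algebraMap_smul, map_add, map_smul, hf]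

theorem coeff_eq (v : Module.Basis (Fin 2) R M) {p q r s : R}
    (h : p • v 0 + q • v 1 = r • v 0 + s • v 1) : p = r ∧ q = s := by
  have h0 := congrArg (v.repr · 0) h
  have h1 := congrArg (v.repr · 1) h
  simp at h0 h1
  exact ⟨h0, h1⟩

/-- Commutation of `f` with `ω`, compared coordinate by coordinate, gives four equations;
eliminating `k` and `k'` from them leaves the substitution formulas. -/
theorem HasFormAction.exists_twistedSubst {a b c k a' b' c' k' : R}
    (h : HasFormAction t d v a b c k) (h' : HasFormAction t d v' a' b' c' k')
    (f : M ≃ₗ[QuadAlg t d] M') : ∃ α β γ δ : R, IsUnit (α * δ - β * γ) ∧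
      TwistedSubst α β γ δ a b c a' b' c' := by
  obtain ⟨p, q, r, s, h0, h1, hu⟩ :=
    v'.exists_coeff_fin_two (v.map (f.restrictScalars R))
  have e0 := congrArg f h.fst
  have e1 := congrArg f h.snd
  have hf : ∀ (x : R) (m : M), f (x • m) = x • f m := (f.restrictScalars R).map_smul
  simp only [Module.Basis.map_apply, LinearEquiv.restrictScalars_apply] at h0 h1
  simp only [map_add, hf, map_smul, h0, h1, smul_add, omega_smul_smul, h'.fst, h'.snd] at e0 e1
  obtain ⟨E1, E2⟩ := coeff_eq v' (p := -(p * k') - q * c') (q := p * a' - q * (b' + k'))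
    (r := -(k * p) + a * r) (s := -(k * q) + a * s) (by linear_combination (norm := module) e0)
  obtain ⟨E3, E4⟩ := coeff_eq v' (p := -(r * k') - s * c') (q := r * a' - s * (b' + k'))
    (r := -(c * p) - (b + k) * r) (s := -(c * q) - (b + k) * s)
    (by linear_combination (norm := module) e1)
  -- The matrix of `f` is transposed, and its off-diagonal signs change because `m ∧ ωm` has middle
  -- coefficient `-b`.
  refine ⟨p, -r, -q, s, by convert hu using 1; ring, ?_, ?_, ?_⟩
  · linear_combination -p * E2 + q * E1
  · linear_combination p * E4 - q * E3 - s * E1 + r * E2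
  · linear_combination s * E3 - r * E4

end Modules

end CommRing

/-! ### From primitive forms to invertible ideals -/

section Domain

variable {R : Type u} [CommRing R] [IsDomain R] {t d : R}

theorem HasFormAction.nonempty_linearEquiv {M M' : Type*} [AddCommGroup M] [Module R M]
    [Module (QuadAlg t d) M] [IsScalarTower R (QuadAlg t d) M] [AddCommGroup M'] [Module R M']
    [Module (QuadAlg t d) M'] [IsScalarTower R (QuadAlg t d) M'] {v : Module.Basis (Fin 2) R M}
    {v' : Module.Basis (Fin 2) R M'} (h2 : (2 : R) ≠ 0) {a b c k a' b' c' k' α β γ δ : R}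
    (h : HasFormAction t d v a b c k) (h' : HasFormAction t d v' a' b' c' k')
    (hk : 2 * k = t - b) (hk' : 2 * k' = t - b') (hu : IsUnit (α * δ - β * γ))
    (hs : TwistedSubst α β γ δ a b c a' b' c') : Nonempty (M ≃ₗ[QuadAlg t d] M') := by
  obtain ⟨w, hw0, hw1⟩ := v'.exists_of_isUnit_det_fin_two
    (α := α) (β := -γ) (γ := -β) (δ := δ) (by convert hu using 1; ring)
  -- Only `2k` and `2k'` are known in terms of the forms, so the four intertwining identities are
  -- proved after multiplication by twice the determinant.
  have hD : 2 * (α * δ - β * γ) ≠ 0 := mul_ne_zero h2 hu.ne_zero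
  have E1 : -(α * k') + γ * c' = -(k * α) - a * β := by
    apply mul_left_cancel₀ hD
    linear_combination -α * (α * δ - β * γ) * hk' + α * (α * δ - β * γ) * hk - α * hs.snd +
      2 * β * hs.fst
  have E2 : α * a' + γ * (b' + k') = k * γ + a * δ := by
    apply mul_left_cancel₀ hD
    linear_combination γ * (α * δ - β * γ) * hk' - γ * (α * δ - β * γ) * hk + γ * hs.snd -
      2 * δ * hs.fst
  have E3 : β * k' - δ * c' = -(c * α) + (b + k) * β := by
    apply mul_left_cancel₀ hD
    linear_combination β * (α * δ - β * γ) * hk' - β * (α * δ - β * γ) * hk - β * hs.snd +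
      2 * α * hs.trd
  have E4 : -(β * a') - δ * (b' + k') = c * γ - (b + k) * δ := by
    apply mul_left_cancel₀ hD
    linear_combination -δ * (α * δ - β * γ) * hk' + δ * (α * δ - β * γ) * hk + δ * hs.snd -
      2 * γ * hs.trd
  let f := v.equiv w (Equiv.refl _)
  let ω : M →ₗ[R] M := Algebra.lsmul R R M (omega t d)
  let ω' : M' →ₗ[R] M' := Algebra.lsmul R R M' (omega t d)
  have hf : f.toLinearMap ∘ₗ ω = ω' ∘ₗ f.toLinearMap := by
    apply v.ext
    intro i
    fin_cases i
    · simp only [Fin.zero_eta, LinearMap.comp_apply, ω, ω', Algebra.lsmul_coe, h.fst, map_add,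
        map_smul, LinearEquiv.coe_coe, f, Module.Basis.equiv_apply, Equiv.refl_apply, hw0, hw1,
        smul_add, h'.fst, h'.snd]
      linear_combination (norm := module) (-E1) • v' 0 - E2 • v' 1
    · simp only [Fin.mk_one, LinearMap.comp_apply, ω, ω', Algebra.lsmul_coe, h.snd, map_add,
        map_smul, LinearEquiv.coe_coe, f, Module.Basis.equiv_apply, Equiv.refl_apply, hw0, hw1,
        smul_add, h'.fst, h'.snd]
      linear_combination (norm := module) (-E3) • v' 0 - E4 • v' 1
  exact ⟨{ f with
    map_smul' := map_smul_of_map_omega_smul f.toLinearMap fun m => LinearMap.congr_fun hf m }⟩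

theorem algebraMap_mem_nonZeroDivisors {a : R} (ha : a ≠ 0) :
    algebraMap R (QuadAlg t d) a ∈ nonZeroDivisors (QuadAlg t d) := by
  rw [mem_nonZeroDivisors_iff_right]
  intro x hx
  obtain ⟨r, s, rfl⟩ := exists_eq_add_mul_omega x
  obtain ⟨hr, hs⟩ := eq_zero_of_add_mul_omega (t := t) (d := d) (r := r * a) (s := s * a) (by
    rw [← hx, map_mul, map_mul]
    ring)
  rw [(mul_eq_zero.1 hr).resolve_right ha, (mul_eq_zero.1 hs).resolve_right ha]
  simp

/-- With `θ = ω + k`, the conjugate is `θ' = -b - θ` and `θθ' = ac`. The product of `⟨θ, a⟩` and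
`⟨θ', a⟩` is thus `a⟨c, θ, θ', a⟩`; the last ideal contains `a`, `b = -(θ + θ')` and `c`, hence is
the unit ideal by primitivity. -/
theorem formIdeal_invertible {a b c k : R} (ha : a ≠ 0) (hprim : Ideal.span {a, b, c} = ⊤)
    (hk : 2 * k = t - b) (hac : k ^ 2 - t * k - d = a * c) :
    Module.Invertible (QuadAlg t d) (formIdeal t d k a) := by
  refine Ideal.invertible_of_mul_eq_span_singleton (algebraMap_mem_nonZeroDivisors ha)
    (J := Ideal.span {-algebraMap R _ b - (omega t d + algebraMap R _ k), algebraMap R _ a}) ?_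
  have hω := omega_mul_omega (t := t) (d := d)
  have hk' := congrArg (algebraMap R (QuadAlg t d)) hk
  have hac' := congrArg (algebraMap R (QuadAlg t d)) hac
  simp only [map_mul, map_sub, map_pow, map_ofNat] at hk' hac'
  have hθ : (omega t d + algebraMap R _ k) *
      (-algebraMap R _ b - (omega t d + algebraMap R _ k)) =
        algebraMap R _ c * algebraMap R _ a := by
    linear_combination (-1 : QuadAlg t d) * hω + hac' -
      (omega t d + algebraMap R (QuadAlg t d) k) * hk'
  rw [formIdeal, Ideal.span_pair_mul_span_pair]
  apply le_antisymm
  · rw [Ideal.span_le]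
    rintro x (rfl | rfl | rfl | rfl)
    · rw [hθ]
      exact Ideal.mul_mem_left _ _ (Ideal.mem_span_singleton_self _)
    · exact Ideal.mul_mem_left _ _ (Ideal.mem_span_singleton_self _)
    · exact Ideal.mul_mem_right _ _ (Ideal.mem_span_singleton_self _)
    · exact Ideal.mul_mem_left _ _ (Ideal.mem_span_singleton_self _)
  · rw [Ideal.span_singleton_le_iff_mem]
    have h1 : (1 : R) ∈ Ideal.span {a, b, c} := hprim ▸ Submodule.mem_top
    rw [Ideal.mem_span_insert] at h1
    obtain ⟨x, y, hy, h1⟩ := h1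
    obtain ⟨y, z, rfl⟩ := Ideal.mem_span_pair.1 hy
    have h1' := congrArg (algebraMap R (QuadAlg t d)) h1
    simp only [map_mul, map_add, map_one] at h1'
    set S : Set (QuadAlg t d) := {(omega t d + algebraMap R _ k) *
      (-algebraMap R _ b - (omega t d + algebraMap R _ k)),
      (omega t d + algebraMap R _ k) * algebraMap R _ a,
      algebraMap R _ a * (-algebraMap R _ b - (omega t d + algebraMap R _ k)),
      algebraMap R _ a * algebraMap R _ a} with hS
    have m1 := Ideal.subset_span (show _ ∈ S from .inl rfl)
    have m2 := Ideal.subset_span (show _ ∈ S from .inr (.inl rfl))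
    have m3 := Ideal.subset_span (show _ ∈ S from .inr (.inr (.inl rfl)))
    have m4 := Ideal.subset_span (show _ ∈ S from .inr (.inr (.inr rfl)))
    -- This element is `x a² - y (aθ + aθ') + z θθ' = a (xa + yb + zc) = a`.
    have := Ideal.add_mem _ (Ideal.add_mem _ (Ideal.mul_mem_left _ (algebraMap R _ x) m4)
      (Ideal.mul_mem_left _ (-algebraMap R _ y) (Ideal.add_mem _ m2 m3)))
      (Ideal.mul_mem_left _ (algebraMap R _ z) m1)
    convert this using 1
    linear_combination algebraMap R _ a * h1' - algebraMap R _ z * hθ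

theorem exists_basis_formIdeal {a b c k : R} (ha : a ≠ 0)
    (hk : 2 * k = t - b) (hac : k ^ 2 - t * k - d = a * c) :
    ∃ v : Module.Basis (Fin 2) R (formIdeal t d k a), HasFormAction t d v a b c k := by
  have hω := omega_mul_omega (t := t) (d := d)
  have hk' := congrArg (algebraMap R (QuadAlg t d)) hk
  have hac' := congrArg (algebraMap R (QuadAlg t d)) hac
  simp only [map_mul, map_sub, map_pow, map_ofNat] at hk' hac'
  have h0 : omega t d * algebraMap R _ a =
      -algebraMap R _ k * algebraMap R _ a +
        algebraMap R _ a * (omega t d + algebraMap R _ k) := by ring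
  have h1 : omega t d * (omega t d + algebraMap R _ k) = -algebraMap R _ c * algebraMap R _ a +
      -(algebraMap R _ b + algebraMap R _ k) * (omega t d + algebraMap R _ k) := by
    linear_combination hω - hac' + (omega t d + algebraMap R (QuadAlg t d) k) * hk'
  let v0 : formIdeal t d k a := ⟨algebraMap R _ a, Ideal.subset_span (.inr rfl)⟩
  let v1 : formIdeal t d k a := ⟨omega t d + algebraMap R _ k, Ideal.subset_span (.inl rfl)⟩
  have hli : LinearIndependent R ![v0, v1] := by
    rw [LinearIndependent.pair_iff]
    intro r s h
    have h' := congrArg Subtype.val h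
    simp only [v0, v1, Submodule.coe_add, Submodule.coe_smul_of_tower, Algebra.smul_def,
      ZeroMemClass.coe_zero] at h'
    obtain ⟨hr, rfl⟩ := eq_zero_of_add_mul_omega (t := t) (d := d) (r := r * a + s * k) (s := s)
      (by rw [← h', map_add, map_mul, map_mul]; ring)
    exact ⟨by simpa [ha] using hr, rfl⟩
  have hsp : ⊤ ≤ Submodule.span R (Set.range ![v0, v1]) := by
    rintro ⟨x, hx⟩ -
    simp only [Matrix.range_cons, Matrix.range_empty, Set.union_empty, Set.singleton_union]
    rw [Submodule.mem_span_pair]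
    obtain ⟨x, y, rfl⟩ := Ideal.mem_span_pair.1 hx
    obtain ⟨r, s, rfl⟩ := exists_eq_add_mul_omega x
    obtain ⟨r', s', rfl⟩ := exists_eq_add_mul_omega y
    -- Expand `(r + sω)(ω + k) + (r' + s'ω)a` and reduce the products with `ω` by `h1` and `h0`.
    refine ⟨-s * c + r' - s' * k, r - s * (b + k) + s' * a, Subtype.ext ?_⟩
    simp only [v0, v1, Submodule.coe_add, Submodule.coe_smul_of_tower, Algebra.smul_def, map_sub,
      map_add, map_mul, map_neg]
    linear_combination -algebraMap R _ s' * h0 - algebraMap R _ s * h1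
  refine ⟨Module.Basis.mk hli hsp, ?_, ?_⟩
  · apply Subtype.ext
    simpa [v0, v1, Algebra.smul_def] using h0
  · apply Subtype.ext
    simpa [v0, v1, Algebra.smul_def] using h1

end Domain

end QuadAlg

/-! ### Restriction of scalars: projectivity and rank -/

theorem Module.Projective.of_isScalarTower (R A M : Type*) [CommRing R] [CommRing A] [Algebra R A]
    [AddCommGroup M] [Module R M] [Module A M] [IsScalarTower R A M] [Module.Free R A]
    [Module.Finite A M] [Module.Projective A M] : Module.Projective R M := by
  obtain ⟨n, f, hf⟩ := Module.Finite.exists_fin' A M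
  obtain ⟨g, hg⟩ := Module.projective_lifting_property f LinearMap.id hf
  exact .of_split (g.restrictScalars R) (f.restrictScalars R)
    (LinearMap.ext fun m => LinearMap.congr_fun hg m)

/-- `A` need not be a domain, so scalars are extended to the fraction field `K` of `R`: `A ⊗ K` is
finite over `K`, hence Artinian, and an invertible module over it is free of rank one. Ranks over
`R` are unchanged by this extension. -/
theorem Module.Invertible.finrank_eq_of_finite (R A M : Type*) [CommRing R] [IsDomain R]
    [CommRing A] [Algebra R A] [Module.Finite R A] [AddCommGroup M] [Module R M] [Module A M]
    [IsScalarTower R A M] [Module.Invertible A M] :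
    Module.finrank R M = Module.finrank R A := by
  let K := FractionRing R
  have hfin : IsArtinianRing (K ⊗[R] A) := IsArtinianRing.of_finite K _
  have hart : IsArtinianRing (A ⊗[R] K) :=
    (Algebra.TensorProduct.comm R K A).surjective.isArtinianRing
  have hfree : Module.Free (A ⊗[R] K) ((A ⊗[R] K) ⊗[A] M) := inferInstance
  obtain ⟨e⟩ := Module.Invertible.free_iff_linearEquiv.1 hfree
  let e1 : M ⊗[R] K ≃ₗ[R] A ⊗[R] K :=
    ((TensorProduct.AlgebraTensorModule.cancelBaseChange R A A M K).symm ≪≫ₗ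
      TensorProduct.comm A M (A ⊗[R] K) ≪≫ₗ e.restrictScalars A).restrictScalars R
  let e2 : K ⊗[R] M ≃ₗ[R] K ⊗[R] A :=
    TensorProduct.comm R K M ≪≫ₗ e1 ≪≫ₗ TensorProduct.comm R A K
  have h1 := IsLocalizedModule.finrank_eq (nonZeroDivisors R) (TensorProduct.mk R K M 1) le_rfl
  have h2 := IsLocalizedModule.finrank_eq (nonZeroDivisors R) (TensorProduct.mk R K A 1) le_rfl
  rw [← h1, ← h2, e2.finrank_eq]

/-! ### From invertible modules to primitive forms -/

namespace QuadAlg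

variable {R : Type u} [CommRing R] {t d : R} {M : Type*} [AddCommGroup M] [Module R M]
  [Module (QuadAlg t d) M] [IsScalarTower R (QuadAlg t d) M]

/-- Primitivity comes from invertibility: `ω + k` sends `v 0` to `a • v 1` and `v 1` to `-c • v 0 -
b • v 1`, so it maps `M` into `JM` and lies in the extension of `J = ⟨a, b, c⟩`. Its `ω`-coordinate
`1` is then in `J`. -/
theorem exists_hasFormAction [Module.Invertible (QuadAlg t d) M] (v : Module.Basis (Fin 2) R M) :
    ∃ a b c k : R, HasFormAction t d v a b c k ∧ Ideal.span {a, b, c} = ⊤ ∧ 2 * k = t - b ∧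
      k ^ 2 - t * k - d = a * c := by
  obtain ⟨k, a, h0⟩ : ∃ k a : R, omega t d • v 0 = -k • v 0 + a • v 1 :=
    ⟨-v.repr (omega t d • v 0) 0, v.repr (omega t d • v 0) 1, by
      rw [neg_neg, ← Fin.sum_univ_two fun i => v.repr (omega t d • v 0) i • v i, v.sum_repr]⟩
  obtain ⟨b, c, h1⟩ : ∃ b c : R, omega t d • v 1 = -c • v 0 + -(b + k) • v 1 :=
    ⟨-v.repr (omega t d • v 1) 1 - k, -v.repr (omega t d • v 1) 0, by
      rw [sub_add_cancel, neg_neg, neg_neg,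
        ← Fin.sum_univ_two fun i => v.repr (omega t d • v 1) i • v i, v.sum_repr]⟩
  set J : Ideal R := Ideal.span {a, b, c} with hJ
  have ha : a ∈ J := Ideal.subset_span (by simp)
  have hb : b ∈ J := Ideal.subset_span (by simp)
  have hc : c ∈ J := Ideal.subset_span (by simp)
  have hprim : J = ⊤ := by
    have hmem : ∀ r ∈ J, ∀ m : M,
        r • m ∈ J.map (algebraMap R (QuadAlg t d)) • (⊤ : Submodule (QuadAlg t d) M) := by
      intro r hr m
      rw [← algebraMap_smul (QuadAlg t d) r m]
      exact Submodule.smul_mem_smul (Ideal.mem_map_of_mem _ hr) Submodule.mem_top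
    have h : algebraMap R (QuadAlg t d) k + algebraMap R (QuadAlg t d) 1 * omega t d ∈
        J.map (algebraMap R (QuadAlg t d)) := by
      refine Module.Invertible.mem_of_forall_smul_mem (M := M) _ fun m => ?_
      rw [← v.sum_repr m, Fin.sum_univ_two]
      have : (algebraMap R (QuadAlg t d) k + algebraMap R (QuadAlg t d) 1 * omega t d) •
          (v.repr m 0 • v 0 + v.repr m 1 • v 1) =
          a • (v.repr m 0 • v 1) - c • (v.repr m 1 • v 0) - b • (v.repr m 1 • v 1) := by
        rw [map_one, one_mul, add_smul, algebraMap_smul, smul_add (omega t d), omega_smul_smul,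
          omega_smul_smul, h0, h1]
        module
      rw [this]
      exact sub_mem (sub_mem (hmem _ ha _) (hmem _ hc _)) (hmem _ hb _)
    exact (Ideal.eq_top_iff_one J).2 (mem_of_add_mul_omega_mem_map h)
  have e0 := omega_smul_omega_smul (t := t) (d := d) (v 0)
  have e1 := omega_smul_omega_smul (t := t) (d := d) (v 1)
  simp only [h0, h1, smul_add, omega_smul_smul] at e0 e1
  obtain ⟨E1, E2⟩ := coeff_eq v (p := k ^ 2 - a * c) (q := -(a * (2 * k + b)))
    (r := d + t * k) (s := -(t * a)) (by linear_combination (norm := module) e0)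
  obtain ⟨E3, E4⟩ := coeff_eq v (p := c * (2 * k + b)) (q := (b + k) ^ 2 - a * c)
    (r := t * c) (s := d + t * (b + k)) (by linear_combination (norm := module) e1)
  -- The equation of `ω` only shows that `2k + b - t` kills `a`, `b` and `c`; primitivity makes it
  -- zero.
  have hτ : ∀ r ∈ J, r * (2 * k + b - t) = 0 := by
    intro r hr
    obtain ⟨x, y, hy, rfl⟩ := Ideal.mem_span_insert.1 hr
    obtain ⟨y, z, rfl⟩ := Ideal.mem_span_pair.1 hy
    linear_combination -x * E2 + y * (E4 - E1) + z * E3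
  have hk := hτ 1 (hprim ▸ Submodule.mem_top)
  exact ⟨a, b, c, k, ⟨h0, h1⟩, hprim, by linear_combination hk, by linear_combination E1⟩

end QuadAlg

/-! ### Invariants under substitution, and existence of expressions -/

namespace TwistedSubst

variable {R : Type u} [CommRing R]

theorem discrim [IsDomain R] {α β γ δ a b c a' b' c' : R}
    (hu : IsUnit (α * δ - β * γ)) (h : TwistedSubst α β γ δ a b c a' b' c') :
    b' ^ 2 - 4 * a' * c' = b ^ 2 - 4 * a * c := by
  apply mul_left_cancel₀ (pow_ne_zero 2 hu.ne_zero)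
  linear_combination 4 * (α * δ - β * γ) * c * h.fst +
    4 * (a' * α ^ 2 + b' * (α * γ) + c' * γ ^ 2) * h.trd -
    ((α * δ - β * γ) * b + (2 * a' * (α * β) + b' * (α * δ + β * γ) + 2 * c' * (γ * δ))) * h.snd

theorem span_le {α β γ δ a b c a' b' c' : R}
    (hu : IsUnit (α * δ - β * γ)) (h : TwistedSubst α β γ δ a b c a' b' c') :
    Ideal.span {a, b, c} ≤ Ideal.span {a', b', c'} := by
  have key : ∀ x p q r : R, (α * δ - β * γ) * x = a' * p + b' * q + c' * r →
      x ∈ Ideal.span {a', b', c'} := by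
    intro x p q r hx
    rw [← Ideal.unit_mul_mem_iff_mem _ hu, hx]
    exact add_mem (add_mem (Ideal.mul_mem_right _ _ (Ideal.subset_span (by simp)))
      (Ideal.mul_mem_right _ _ (Ideal.subset_span (by simp))))
      (Ideal.mul_mem_right _ _ (Ideal.subset_span (by simp)))
  rw [Ideal.span_le]
  rintro x (rfl | rfl | rfl)
  · exact key _ _ _ _ h.fst
  · exact key _ (2 * (α * β)) (α * δ + β * γ) (2 * (γ * δ)) (by rw [h.snd]; ring)
  · exact key _ _ _ _ h.trd

theorem sub_mem {α β γ δ a b c a' b' c' : R}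
    (hu : IsUnit (α * δ - β * γ)) (h : TwistedSubst α β γ δ a b c a' b' c') :
    b' - b ∈ Ideal.span {(2 : R)} := by
  rw [← Ideal.unit_mul_mem_iff_mem _ hu, Ideal.mem_span_singleton]
  -- Modulo `2`, `αδ + βγ` is the determinant; the witness collects the even remainder.
  exact ⟨-(a' * (α * β) + b' * (β * γ) + c' * (γ * δ)), by linear_combination -h.snd⟩

end TwistedSubst

namespace TwistedForm

variable {R : Type u} [CommRing R]

theorem exists_basis [IsDomain R] (Q : TwistedForm R)
    (hfree : ∀ (M : Type u) [AddCommGroup M] [Module R M],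
      Module.Finite R M → Module.Projective R M → Module.Free R M) :
    Nonempty (Module.Basis (Fin 2) R Q.V) := by
  have := hfree Q.V inferInstance inferInstance
  have h := Q.rank_eq ⊥
  rw [Module.rankAtStalk_eq_finrank_of_free] at h
  exact ⟨Module.finBasisOfFinrankEq R Q.V h⟩

theorem exists_hasExpression_ne_zero [IsDomain R] {Q : TwistedForm R} (hQ : Q.IsPrimitive)
    (e : Module.Basis (Fin 2) R Q.V) :
    ∃ (e : Module.Basis (Fin 2) R Q.V) (a b c : R), Q.HasExpression e a b c ∧ a ≠ 0 := by
  obtain ⟨a, b, c, h⟩ := Q.exists_hasExpression e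
  by_cases ha : a = 0
  · subst ha
    by_cases hc : c = 0
    · subst hc
      have hb : b ≠ 0 := by
        rintro rfl
        simpa using hQ e _ _ _ h
      -- Substituting `y - x` for `y` in `bxy` produces the leading coefficient `-b`.
      have hu : IsUnit ((1 : R) * 1 - 0 * -1) := by simp
      obtain ⟨e', h0, h1⟩ := e.exists_of_isUnit_det_fin_two_symm hu
      exact ⟨e', -b, b, 0, h.of_twistedSubst h0 h1 ⟨by ring, by ring, by ring⟩,
        neg_ne_zero.2 hb⟩
    · have hu : IsUnit ((0 : R) * 0 - 1 * 1) := by simp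
      obtain ⟨e', h0, h1⟩ := e.exists_of_isUnit_det_fin_two_symm hu
      exact ⟨e', -c, -b, 0, h.of_twistedSubst h0 h1 ⟨by ring, by ring, by ring⟩,
        neg_ne_zero.2 hc⟩
  · exact ⟨e, a, b, c, h, ha⟩

theorem exists_primitiveOfType [IsDomain R] {a b c : R} (h : Ideal.span {a, b, c} = ⊤) :
    ∃ (Q : PrimitiveOfType R (b ^ 2 - 4 * a * c) (Ideal.Quotient.mk _ b))
      (e : Module.Basis (Fin 2) R Q.1.V), Q.1.HasExpression e a b c := by
  let e : Module.Basis (Fin 2) R (Fin 2 → R) := Pi.basisFun R (Fin 2)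
  let Q : TwistedForm R :=
    { V := Fin 2 → R
      rank_eq := fun p => by rw [Module.rankAtStalk_eq_finrank_of_free]; simp
      q := (a • SymSquare.mk (e 0) (e 0) + b • SymSquare.mk (e 0) (e 1)
        + c • SymSquare.mk (e 1) (e 1)) ⊗ₜ[R] detForm e }
  have hQ : Q.HasExpression e a b c := rfl
  have key : ∀ (e' : Module.Basis (Fin 2) R Q.V) (a' b' c' : R), Q.HasExpression e' a' b' c' →
      ∃ α β γ δ : R, IsUnit (α * δ - β * γ) ∧ TwistedSubst α β γ δ a b c a' b' c' := by
    intro e' a' b' c' h'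
    obtain ⟨α, β, γ, δ, h0, h1, hu⟩ := Module.Basis.exists_coeff_fin_two e e'
    exact ⟨α, β, γ, δ, hu, hQ.twistedSubst h0 h1 h'⟩
  refine ⟨⟨Q, fun e' a' b' c' h' => ?_, fun e' a' b' c' h' => ?_, fun e' a' b' c' h' => ?_⟩, e, hQ⟩
  · obtain ⟨α, β, γ, δ, hu, hs⟩ := key e' a' b' c' h'
    exact top_le_iff.1 (h ▸ hs.span_le hu)
  · obtain ⟨α, β, γ, δ, hu, hs⟩ := key e' a' b' c' h'
    exact hs.discrim hu
  · obtain ⟨α, β, γ, δ, hu, hs⟩ := key e' a' b' c' h'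
    exact Ideal.Quotient.eq.2 (hs.sub_mem hu)

theorem Equivalent.exists_twistedSubst {Q Q' : TwistedForm R} (h : Equivalent Q Q')
    {e : Module.Basis (Fin 2) R Q.V} {e' : Module.Basis (Fin 2) R Q'.V} {a b c a' b' c' : R}
    (hQ : Q.HasExpression e a b c) (hQ' : Q'.HasExpression e' a' b' c') :
    ∃ α β γ δ : R, IsUnit (α * δ - β * γ) ∧ TwistedSubst α β γ δ a b c a' b' c' := by
  obtain ⟨f, hf⟩ := h
  obtain ⟨α, β, γ, δ, h0, h1, hu⟩ := (e.map f).exists_coeff_fin_two e'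
  exact ⟨α, β, γ, δ, hu, (hQ.transport hf).twistedSubst h0 h1 hQ'⟩

theorem equivalent_of_twistedSubst {Q Q' : TwistedForm R} {e : Module.Basis (Fin 2) R Q.V}
    {e' : Module.Basis (Fin 2) R Q'.V} {a b c a' b' c' α β γ δ : R}
    (hQ : Q.HasExpression e a b c) (hQ' : Q'.HasExpression e' a' b' c')
    (hu : IsUnit (α * δ - β * γ)) (hs : TwistedSubst α β γ δ a b c a' b' c') :
    Equivalent Q Q' := by
  obtain ⟨e'', h0, h1⟩ := e'.exists_of_isUnit_det_fin_two_symm hu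
  exact equivalent_of_hasExpression hQ (hQ'.of_twistedSubst h0 h1 hs)

end TwistedForm

/-! ### The correspondence on classes -/

namespace TwistedForm

variable {R : Type u} [CommRing R] [IsDomain R] {π : R ⧸ Ideal.span {(2 : R)}} {Δ t d : R}

/-- The class `p` is that of the ideal `⟨ω + k, a⟩` attached to an expression `[a, b, c]` of `Q`
with `a ≠ 0`. -/
def PrimitiveOfType.HasIdealClass (t d : R) (Q : PrimitiveOfType R Δ π)
    (p : CommRing.Pic (QuadAlg t d)) : Prop :=
  ∃ (e : Module.Basis (Fin 2) R Q.1.V) (a b c k : R), Q.1.HasExpression e a b c ∧ a ≠ 0 ∧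
    2 * k = t - b ∧ ∃ _ : Module.Invertible (QuadAlg t d) (QuadAlg.formIdeal t d k a),
      p = CommRing.Pic.mk (QuadAlg t d) (QuadAlg.formIdeal t d k a)

theorem HasExpression.constant_eq (h2 : (2 : R) ≠ 0) (hd : Δ - t ^ 2 = 4 * d)
    {Q : PrimitiveOfType R Δ π} {e : Module.Basis (Fin 2) R Q.1.V} {a b c k : R}
    (h : Q.1.HasExpression e a b c) (hk : 2 * k = t - b) : k ^ 2 - t * k - d = a * c := by
  have hΔ := Q.2.2.1 e a b c h
  -- Four times the left side is `(2k - t)² - t² - 4d = b² - Δ`.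
  apply mul_left_cancel₀ (mul_ne_zero h2 h2)
  linear_combination hΔ + hd + (2 * k - t - b) * hk

theorem exists_half {R : Type u} [CommRing R] {π : R ⧸ Ideal.span {(2 : R)}} {Δ t : R}
    (ht : Ideal.Quotient.mk (Ideal.span {(2 : R)}) t = π)
    {Q : PrimitiveOfType R Δ π} {e : Module.Basis (Fin 2) R Q.1.V} {a b c : R}
    (h : Q.1.HasExpression e a b c) : ∃ k, 2 * k = t - b := by
  have h1 := ht.trans (Q.2.2.2 e a b c h).symm
  rw [Ideal.Quotient.eq, Ideal.mem_span_singleton] at h1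
  obtain ⟨k, hk⟩ := h1
  exact ⟨k, hk.symm⟩

theorem HasExpression.formIdeal_invertible (h2 : (2 : R) ≠ 0) (hd : Δ - t ^ 2 = 4 * d)
    {Q : PrimitiveOfType R Δ π} {e : Module.Basis (Fin 2) R Q.1.V} {a b c k : R}
    (h : Q.1.HasExpression e a b c) (ha : a ≠ 0) (hk : 2 * k = t - b) :
    Module.Invertible (QuadAlg t d) (QuadAlg.formIdeal t d k a) :=
  QuadAlg.formIdeal_invertible ha (Q.2.1 e a b c h) hk (h.constant_eq h2 hd hk)

namespace PrimitiveOfType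

theorem exists_hasIdealClass (h2 : (2 : R) ≠ 0)
    (hfree : ∀ (M : Type u) [AddCommGroup M] [Module R M],
      Module.Finite R M → Module.Projective R M → Module.Free R M)
    (ht : Ideal.Quotient.mk (Ideal.span {(2 : R)}) t = π) (hd : Δ - t ^ 2 = 4 * d)
    (Q : PrimitiveOfType R Δ π) : ∃ p, Q.HasIdealClass t d p := by
  obtain ⟨e⟩ := Q.1.exists_basis hfree
  obtain ⟨e, a, b, c, h, ha⟩ := exists_hasExpression_ne_zero Q.2.1 e
  obtain ⟨k, hk⟩ := exists_half ht h
  have := h.formIdeal_invertible h2 hd ha hk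
  exact ⟨_, e, a, b, c, k, h, ha, hk, this, rfl⟩

/-- One direction makes the ideal class independent of the basis and of the representative; the
other is injectivity. -/
theorem HasIdealClass.eq_iff_equivalent (h2 : (2 : R) ≠ 0) (hd : Δ - t ^ 2 = 4 * d)
    {Q Q' : PrimitiveOfType R Δ π} {p p' : CommRing.Pic (QuadAlg t d)}
    (h : Q.HasIdealClass t d p) (h' : Q'.HasIdealClass t d p') :
    p = p' ↔ Equivalent Q.1 Q'.1 := by
  obtain ⟨e, a, b, c, k, hQ, ha, hk, _, rfl⟩ := h
  obtain ⟨e', a', b', c', k', hQ', ha', hk', _, rfl⟩ := h'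
  obtain ⟨v, hv⟩ := QuadAlg.exists_basis_formIdeal ha hk (hQ.constant_eq h2 hd hk)
  obtain ⟨v', hv'⟩ := QuadAlg.exists_basis_formIdeal ha' hk' (hQ'.constant_eq h2 hd hk')
  rw [CommRing.Pic.mk_eq_mk_iff]
  constructor
  · rintro ⟨f⟩
    obtain ⟨α, β, γ, δ, hu, hs⟩ := hv.exists_twistedSubst hv' f
    exact equivalent_of_twistedSubst hQ hQ' hu hs
  · intro h
    obtain ⟨α, β, γ, δ, hu, hs⟩ := h.exists_twistedSubst hQ hQ'
    exact hv.nonempty_linearEquiv h2 hv' hk hk' hu hs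

theorem exists_hasIdealClass_of_pic (h2 : (2 : R) ≠ 0)
    (hfree : ∀ (M : Type u) [AddCommGroup M] [Module R M],
      Module.Finite R M → Module.Projective R M → Module.Free R M)
    (ht : Ideal.Quotient.mk (Ideal.span {(2 : R)}) t = π) (hd : Δ - t ^ 2 = 4 * d)
    (p : CommRing.Pic (QuadAlg t d)) : ∃ Q : PrimitiveOfType R Δ π, Q.HasIdealClass t d p := by
  let _ : Module R p.AsModule := Module.compHom _ (algebraMap R (QuadAlg t d))
  have : IsScalarTower R (QuadAlg t d) p.AsModule :=
    .of_algebraMap_smul fun _ _ => rfl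
  have hfin : Module.Finite R p.AsModule := .trans (QuadAlg t d) _
  have hproj : Module.Projective R p.AsModule := .of_isScalarTower R (QuadAlg t d) _
  have := hfree p.AsModule hfin hproj
  have hrank : Module.finrank R p.AsModule = 2 := by
    rw [Module.Invertible.finrank_eq_of_finite R (QuadAlg t d), QuadAlg.finrank_eq]
  let v := Module.finBasisOfFinrankEq R p.AsModule hrank
  obtain ⟨a, b, c, k, hv, hprim, hk, hac⟩ := QuadAlg.exists_hasFormAction (t := t) (d := d) v
  obtain rfl : Δ = b ^ 2 - 4 * a * c := by
    linear_combination hd - 4 * hac + (2 * k - t - b) * hk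
  obtain rfl : Ideal.Quotient.mk (Ideal.span {(2 : R)}) b = π := by
    rw [← ht, eq_comm, Ideal.Quotient.eq, Ideal.mem_span_singleton]
    exact ⟨k, hk.symm⟩
  obtain ⟨Q, e, hQ⟩ := exists_primitiveOfType hprim
  -- The coefficient `a` read off from the module may vanish, so another expression of the same
  -- form, with `a' ≠ 0`, supplies the ideal; the two expressions differ by a substitution, which
  -- makes this ideal isomorphic to the module.
  obtain ⟨_, e', a', b', c', k', hQ', ha', hk', hinv, -⟩ := exists_hasIdealClass h2 hfree ht hd Q
  refine ⟨Q, e', a', b', c', k', hQ', ha', hk', hinv, ?_⟩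
  obtain ⟨v', hv'⟩ := QuadAlg.exists_basis_formIdeal ha' hk' (hQ'.constant_eq h2 hd hk')
  obtain ⟨α, β, γ, δ, hu, hs⟩ :=
    (equivalent_equivalence.refl Q.1).exists_twistedSubst hQ hQ'
  obtain ⟨f⟩ := hv.nonempty_linearEquiv h2 hv' hk hk' hu hs
  exact (CommRing.Pic.mk_eq_iff.2 ⟨f.symm⟩).symm

end PrimitiveOfType

end TwistedForm

theorem mainTheorem7 (R : Type u) [CommRing R] [IsDomain R] (hchar : ringChar R ≠ 2)
    (hfree : ∀ (M : Type u) [AddCommGroup M] [Module R M],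
      Module.Finite R M → Module.Projective R M → Module.Free R M)
    (π : R ⧸ Ideal.span {(2 : R)}) (t : R) (ht : Ideal.Quotient.mk (Ideal.span {(2 : R)}) t = π)
    (Δ d : R) (hd : Δ - t ^ 2 = 4 * d) :
    ∃ Φ : TwistedForm.Classes R Δ π ≃ CommRing.Pic (QuadAlg t d),
      ∀ (Q : TwistedForm.PrimitiveOfType R Δ π) (e : Module.Basis (Fin 2) R Q.1.V) (a b c k : R),
        Q.1.HasExpression e a b c → a ≠ 0 → 2 * k = t - b →
          ∃ _ : Module.Invertible (QuadAlg t d) (QuadAlg.formIdeal t d k a),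
            Φ Q.toClass = CommRing.Pic.mk (QuadAlg t d) (QuadAlg.formIdeal t d k a) := by
  have h2 : (2 : R) ≠ 0 := Ring.two_ne_zero hchar
  choose φ hφ using TwistedForm.PrimitiveOfType.exists_hasIdealClass (Δ := Δ) h2 hfree ht hd
  let Ψ : TwistedForm.Classes R Δ π → CommRing.Pic (QuadAlg t d) :=
    Quotient.lift φ fun Q Q' h => ((hφ Q).eq_iff_equivalent h2 hd (hφ Q')).2 h
  have hinj : Function.Injective Ψ := by
    rintro ⟨Q⟩ ⟨Q'⟩ h
    exact Quotient.sound (((hφ Q).eq_iff_equivalent h2 hd (hφ Q')).1 h)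
  have hΨ : ∀ (Q : TwistedForm.PrimitiveOfType R Δ π) p, Q.HasIdealClass t d p →
      Ψ Q.toClass = p := fun Q p hp =>
    ((hφ Q).eq_iff_equivalent h2 hd hp).2 (TwistedForm.equivalent_equivalence.refl Q.1)
  have hsurj : Function.Surjective Ψ := fun p => by
    obtain ⟨Q, hQ⟩ := TwistedForm.PrimitiveOfType.exists_hasIdealClass_of_pic h2 hfree ht hd p
    exact ⟨Q.toClass, hΨ Q p hQ⟩
  refine ⟨Equiv.ofBijective Ψ ⟨hinj, hsurj⟩, fun Q e a b c k h ha hk => ?_⟩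
  have hinv := h.formIdeal_invertible h2 hd ha hk
  exact ⟨hinv, hΨ Q _ ⟨e, a, b, c, k, h, ha, hk, hinv, rfl⟩⟩
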